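/- Let $k$ be an algebraically closed field of characteristic $0$. Let $\mathcal{E}$ be an abelian category which is semi-simple (every object is a finite direct sum of simple objects) and in which every Hom group $\mathrm{Hom}_{\mathcal{E}}(X,Y)$ is finite. Let $k[\mathcal{E}]$ be the $k$-linearization of $\mathcal{E}$: its objects are the objects $X$ of $\mathcal{E}$, written $[X]$; the space $\mathrm{Hom}_{k[\mathcal{E}]}([X],[Y])$ is the $k$-vector space with basis the set $\mathrm{Hom}_{\mathcal{E}}(X,Y)$; and composition is the $k$-bilinear extension of composition in $\mathcal{E}$. Let $k[\mathcal{E}]^{\oplus}$ be its additive envelope, whose objects are finite tuples $(X_1,\dots,X_n)$, $n \ge 0$, of objects of $k[\mathcal{E}]$ and whose morphisms $(X_i)_i \to (Y_j)_j$ are matrices with entries in $\mathrm{Hom}_{k[\mathcal{E}]}(X_i,Y_j)$, composed by matrix multiplication. Let $k[\mathcal{E}]^{\sharp} = (k[\mathcal{E}]^{\oplus})^{\mathrm{kar}}$ be the additive--Karoubi envelope, whose objects are pairs $(X,e)$ with $X$ an object of $k[\mathcal{E}]^{\oplus}$ and $e$ an idempotent endomorphism of $X$, and whose morphisms $(X,e)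 \to (Y,f)$ are the morphisms $\phi \colon X \to Y$ of $k[\mathcal{E}]^{\oplus}$ with $f\phi = \phi = \phi e$. Then the category $k[\mathcal{E}]^{\sharp}$, with its natural additive structure, is a semi-simple abelian category: it is abelian, and every object is a finite direct sum of simple objects. -/

import Mathlib

open CategoryTheory CategoryTheory.Limits

universe w v u

/-- An abelian category is semi-simple if every object is isomorphic to a direct sum of a finite
(possibly empty) family of simple objects. -/
def IsSemisimpleCat (C : Type u) [Category.{v} C] [Abelian C] : Prop :=
  haveI : HasFiniteBiproducts C := Abelian.hasFiniteBiproducts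
  ∀ X : C, ∃ (n : ℕ) (S : Fin n → C), (∀ i, Simple (S i)) ∧ Nonempty (X ≅ ⨁ S)

/-- The `k`-linearization `k[E]`: the objects are those of `E`, and the morphisms `[X] ⟶ [Y]` are
the formal `k`-linear combinations of morphisms `X ⟶ Y` in `E`, composed bilinearly. -/
abbrev Linearization (k : Type w) [Field k] (E : Type u) [Category.{v} E] : Type u :=
  CategoryTheory.Free k E

/-- The additive–Karoubi envelope: the Karoubi envelope (pairs of an object and an idempotent
endomorphism) of the additive envelope (finite tuples of objects, with matrices as morphisms). -/
abbrev AdditiveKaroubi (C : Type u) [Category.{v} C] [Preadditive C] : Type (max 1 u v) :=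
  Idempotents.Karoubi (Mat_ C)

/-! The core is that each finite-dimensional algebra `k[End X]` is semi-simple
(`isSemisimpleRing_end_free`). Any finite family of objects consists of retracts of its direct sum
`X`, so matrices of morphisms become matrices over `k[End X]` and acquire quasi-inverses, `f ≫ g ≫ f
= f`; this passes to the Karoubi envelope. In an idempotent complete additive category such
regularity yields kernels, cokernels and splittings (`abelianOfIsRegularHom`), and
finite-dimensional Hom spaces make repeated splitting stop at simple objects.

To kill the radical of `k[End X]`, let `χ` be an additive character of `End X` built from traces on
`Hom(S, X)`, `S` simple, with `χ(ab)` a nondegenerate pairing, and extend it linearly. If the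
extension vanishes on nilpotents, a radical element `x` pairs to zero with every `b`, and Fourier
inversion on the finite group `End X` gives `x = 0`.

Vanishing on nilpotents is `sum_mul_traceCharacter_eq_zero`. For an automorphism `h` of `Z` and `x`
nilpotent, the operator `z ↦ h ≫ z ≫ x` on `k[Hom(Z, X)]` is nilpotent, so its trace `∑ x_g #{z | h
≫ z ≫ g = z}` is zero. By Fitting's decomposition these fixed points are the morphisms from `(Z,
h⁻¹)` to the invertible part of `(X, g)`, among objects with an automorphism. A Lovász-style
counting argument transfers a linear relation between all such Hom counts to every isomorphism
invariant, and `χ(g)` is an invariant of the invertible part of `g`. -/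

namespace CategoryTheory

/-! ### Von Neumann regular morphisms -/

/-- A morphism is (von Neumann) regular if it has a quasi-inverse. -/
def IsRegularHom {C : Type u} [Category.{v} C] {X Y : C} (f : X ⟶ Y) : Prop :=
  ∃ g : Y ⟶ X, f ≫ g ≫ f = f

namespace IsRegularHom

section

variable {C : Type u} [Category.{v} C] {X Y : C} {f : X ⟶ Y}

lemma exists_retraction (h : IsRegularHom f) [Mono f] : ∃ r, f ≫ r = 𝟙 X := by
  obtain ⟨g, hg⟩ := h
  exact ⟨g, by rw [← cancel_mono f]; simpa using hg⟩

lemma exists_section (h : IsRegularHom f) [Epi f] : ∃ s, s ≫ f = 𝟙 Y := by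
  obtain ⟨g, hg⟩ := h
  exact ⟨g, by rw [← cancel_epi f]; simpa using hg⟩

end

variable {C : Type u} [Category.{v} C] [Preadditive C] {X Y : C} {f : X ⟶ Y}

/-- McCoy's trick: a quasi-inverse may be found after subtracting a correction `f ≫ u ≫ f`, which
permits induction on the size of `f`. -/
lemma of_sub (u : Y ⟶ X) (h : IsRegularHom (f - f ≫ u ≫ f)) : IsRegularHom f := by
  obtain ⟨g, hg⟩ := h
  refine ⟨(𝟙 Y - u ≫ f) ≫ g ≫ (𝟙 X - f ≫ u) + u, ?_⟩
  have h1 : f ≫ (𝟙 Y - u ≫ f) = f - f ≫ u ≫ f := by simp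
  have h2 : (𝟙 X - f ≫ u) ≫ f = f - f ≫ u ≫ f := by simp
  rw [Preadditive.add_comp, Preadditive.comp_add]
  simp only [Category.assoc]
  rw [h2, reassoc_of% h1, hg]
  simp

end IsRegularHom

/-! ### Regularity implies abelian -/

section RegularCategory

variable {C : Type u} [Category.{v} C] [Preadditive C]

/-- A split idempotent `𝟙 - f ≫ g` provides a kernel of `f`. -/
noncomputable def isLimitKernelForkOfSplit {X Y Z : C} {f : X ⟶ Y} {g : Y ⟶ X}
    (i : Z ⟶ X) (p : X ⟶ Z) (hi : i ≫ p = 𝟙 Z) (hp : p ≫ i = 𝟙 X - f ≫ g) (w : i ≫ f = 0) :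
    IsLimit (KernelFork.ofι i w) :=
  KernelFork.IsLimit.ofι i w (fun h _ => h ≫ p)
    (fun h hh => by rw [Category.assoc, hp]; simp [reassoc_of% hh])
    (fun h hh m hm => by rw [← hm, Category.assoc, hi, Category.comp_id])

/-- A split idempotent `𝟙 - g ≫ f` provides a cokernel of `f`. -/
noncomputable def isColimitCokernelCoforkOfSplit {X Y Z : C} {f : X ⟶ Y} {g : Y ⟶ X}
    (i : Z ⟶ Y) (p : Y ⟶ Z) (hi : i ≫ p = 𝟙 Z) (hp : p ≫ i = 𝟙 Y - g ≫ f) (w : f ≫ p = 0) :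
    IsColimit (CokernelCofork.ofπ p w) :=
  CokernelCofork.IsColimit.ofπ p w (fun h _ => i ≫ h)
    (fun h hh => by rw [reassoc_of% hp]; simp [hh])
    (fun h hh m hm => by rw [← hm, reassoc_of% hi])

/-- For a quasi-inverse `g`, the endomorphism `𝟙 - f ≫ g` is idempotent, and its image is the kernel
of `f`. -/
lemma hasKernel_of_isRegularHom [IsIdempotentComplete C] {X Y : C} {f : X ⟶ Y}
    (hf : IsRegularHom f) : HasKernel f := by
  obtain ⟨g, hg⟩ := hf
  obtain ⟨Z, i, p, hi, hp⟩ := IsIdempotentComplete.idempotents_split X (𝟙 X - f ≫ g)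
    (by simp [reassoc_of% hg])
  have w : i ≫ f = 0 := by
    have : i ≫ f = i ≫ (p ≫ i) ≫ f := by simp [reassoc_of% hi]
    rw [this, hp]; simp [hg]
  exact ⟨⟨⟨_, isLimitKernelForkOfSplit i p hi hp w⟩⟩⟩

lemma hasCokernel_of_isRegularHom [IsIdempotentComplete C] {X Y : C} {f : X ⟶ Y}
    (hf : IsRegularHom f) : HasCokernel f := by
  obtain ⟨g, hg⟩ := hf
  obtain ⟨Z, i, p, hi, hp⟩ := IsIdempotentComplete.idempotents_split Y (𝟙 Y - g ≫ f)
    (by simp [hg])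
  have w : f ≫ p = 0 := by
    have : f ≫ p = f ≫ (p ≫ i) ≫ p := by simp [hi]
    rw [this, hp]; simp [reassoc_of% hg]
  exact ⟨⟨⟨_, isColimitCokernelCoforkOfSplit i p hi hp w⟩⟩⟩

/-- An idempotent complete additive category in which every morphism is regular is abelian. -/
@[reducible]
noncomputable def abelianOfIsRegularHom [HasFiniteBiproducts C] [IsIdempotentComplete C]
    (h : ∀ {X Y : C} (f : X ⟶ Y), IsRegularHom f) : Abelian C :=
  { ‹Preadditive C› with
    normalMonoOfMono := fun {X Y} f hf => by
      obtain ⟨r, hr⟩ := (h f).exists_retraction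
      -- A split mono is the kernel of the idempotent complementary to `r ≫ f`.
      exact ⟨⟨Y, 𝟙 Y - r ≫ f, by simp [reassoc_of% hr],
        isLimitKernelForkOfSplit (g := 𝟙 Y) f r hr (by simp) _⟩⟩
    normalEpiOfEpi := fun {X Y} f hf => by
      obtain ⟨s, hs⟩ := (h f).exists_section
      exact ⟨⟨X, 𝟙 X - f ≫ s, by simp [hs],
        isColimitCokernelCoforkOfSplit (g := 𝟙 X) s f hs (by simp) _⟩⟩
    has_finite_products := inferInstance
    has_kernels := ⟨fun f => hasKernel_of_isRegularHom (h f)⟩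
    has_cokernels := ⟨fun f => hasCokernel_of_isRegularHom (h f)⟩ }

end RegularCategory

/-! ### Splitting into simple objects -/

section Decomposition

variable {C : Type u} [Category.{v} C] [Abelian C]

/-- An object which is a direct sum of a finite family of simple objects. -/
def IsFiniteSumOfSimples (X : C) : Prop :=
  ∃ (J : Type) (_ : Fintype J) (_ : DecidableEq J) (S : J → C) (b : Limits.Bicone S),
    (∀ j, Simple (S j)) ∧ ∑ j, b.π j ≫ b.ι j = 𝟙 b.pt ∧ Nonempty (X ≅ b.pt)

lemma IsFiniteSumOfSimples.exists_iso_biproduct {X : C} (h : IsFiniteSumOfSimples X) :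
    haveI : HasFiniteBiproducts C := Abelian.hasFiniteBiproducts
    ∃ (n : ℕ) (S : Fin n → C), (∀ i, Simple (S i)) ∧ Nonempty (X ≅ ⨁ S) := by
  have : HasFiniteBiproducts C := Abelian.hasFiniteBiproducts
  obtain ⟨J, _, _, S, b, hS, hb, ⟨e⟩⟩ := h
  let σ := Fintype.equivFin J
  refine ⟨Fintype.card J, S ∘ σ.symm, fun i => hS _, ⟨e ≪≫ ?_⟩⟩
  exact biproduct.uniqueUpToIso _ (isBilimitOfTotal b hb) ≪≫
    (biproduct.whiskerEquiv σ.symm (fun _ => Iso.refl _)).symm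

lemma IsFiniteSumOfSimples.of_splitting {X A B : C} (i : A ⟶ X) (p : X ⟶ A) (j : B ⟶ X)
    (q : X ⟶ B) (hi : i ≫ p = 𝟙 A) (hj : j ≫ q = 𝟙 B) (hij : i ≫ q = 0) (hji : j ≫ p = 0)
    (htot : p ≫ i + q ≫ j = 𝟙 X) (hA : IsFiniteSumOfSimples A) (hB : IsFiniteSumOfSimples B) :
    IsFiniteSumOfSimples X := by
  obtain ⟨J, _, _, S, b, hS, hb, ⟨e⟩⟩ := hA
  obtain ⟨J', _, _, S', b', hS', hb', ⟨e'⟩⟩ := hB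
  refine ⟨J ⊕ J', inferInstance, inferInstance, Sum.elim S S',
    { pt := X
      π := fun
        | .inl a => p ≫ e.hom ≫ b.π a
        | .inr a => q ≫ e'.hom ≫ b'.π a
      ι := fun
        | .inl a => b.ι a ≫ e.inv ≫ i
        | .inr a => b'.ι a ≫ e'.inv ≫ j
      ι_π := ?_ }, ?_, ?_, ⟨Iso.refl _⟩⟩
  · rintro (a | a) (c | c)
    · by_cases h : a = c
      · subst h; simp [reassoc_of% hi]; rfl
      · simp [reassoc_of% hi, b.ι_π, h]; rfl
    · simp [reassoc_of% hij]; rfl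
    · simp [reassoc_of% hji]; rfl
    · by_cases h : a = c
      · subst h; simp [reassoc_of% hj]; rfl
      · simp [reassoc_of% hj, b'.ι_π, h]; rfl
  · rintro (a | a)
    · exact hS a
    · exact hS' a
  · have h1 : ∑ a, (p ≫ e.hom ≫ b.π a) ≫ b.ι a ≫ e.inv ≫ i = p ≫ i := by
      have : ∀ a, (p ≫ e.hom ≫ b.π a) ≫ b.ι a ≫ e.inv ≫ i =
        (p ≫ e.hom) ≫ (b.π a ≫ b.ι a) ≫ e.inv ≫ i := by simp
      simp only [this]
      rw [← Preadditive.comp_sum, ← Preadditive.sum_comp, hb]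
      simp
    have h2 : ∑ a, (q ≫ e'.hom ≫ b'.π a) ≫ b'.ι a ≫ e'.inv ≫ j = q ≫ j := by
      have : ∀ a, (q ≫ e'.hom ≫ b'.π a) ≫ b'.ι a ≫ e'.inv ≫ j =
        (q ≫ e'.hom) ≫ (b'.π a ≫ b'.ι a) ≫ e'.inv ≫ j := by simp
      simp only [this]
      rw [← Preadditive.comp_sum, ← Preadditive.sum_comp, hb']
      simp
    rw [Fintype.sum_sum_type]
    exact (congrArg₂ (· + ·) h1 h2).trans htot

lemma isFiniteSumOfSimples_of_isZero {X : C} (h : IsZero X) : IsFiniteSumOfSimples X :=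
  ⟨PEmpty, inferInstance, inferInstance, PEmpty.elim,
    { pt := X, π := fun j => j.elim, ι := fun j => j.elim, ι_π := fun j => j.elim },
    fun j => j.elim, h.eq_of_src _ _, ⟨Iso.refl _⟩⟩

lemma isFiniteSumOfSimples_of_simple {X : C} (h : Simple X) : IsFiniteSumOfSimples X :=
  ⟨PUnit, inferInstance, inferInstance, fun _ => X,
    { pt := X, π := fun _ => 𝟙 X, ι := fun _ => 𝟙 X, ι_π := fun j j' => by simp },
    fun _ => h, by simp, ⟨Iso.refl _⟩⟩

/-- An abelian category with finite-dimensional morphism spaces in which every morphism is regular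
is semi-simple. -/
lemma isFiniteSumOfSimples_of_isRegularHom (k : Type w) [Field k] [Linear k C]
    [∀ X Y : C, FiniteDimensional k (X ⟶ Y)]
    (h : ∀ {X Y : C} (f : X ⟶ Y), IsRegularHom f) (X : C) : IsFiniteSumOfSimples X := by
  induction hn : Module.finrank k (X ⟶ X) using Nat.strong_induction_on generalizing X with
  | _ n ih =>
  subst hn
  have key : ∀ {A B : C} (i : A ⟶ X) (p : X ⟶ A) (j : B ⟶ X) (q : X ⟶ B), i ≫ p = 𝟙 A →
      p ≫ i + q ≫ j = 𝟙 X → j ≫ q = 𝟙 B → j ≫ p = 0 → ¬ IsZero B →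
      Module.finrank k (A ⟶ A) < Module.finrank k (X ⟶ X) := by
    intro A B i p j q hi ht hj hji hB
    let φ : (A ⟶ A) →ₗ[k] (X ⟶ X) := Linear.rightComp k X i ∘ₗ Linear.leftComp k A p
    have hφ : ∀ a, φ a = p ≫ a ≫ i := fun a => by simp [φ]
    have hinj : Function.Injective φ := fun a b hab => by
      rw [hφ, hφ] at hab
      have := congrArg (fun t => i ≫ t ≫ p) hab
      simpa [hi, reassoc_of% hi] using this
    -- The identity of `X` is not of the form `p ≫ a ≫ i`: compressing such a morphism to `B` gives
    -- zero, while `B` is nonzero.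
    have hlt : LinearMap.range φ < ⊤ := by
      rw [lt_top_iff_ne_top]
      intro htop
      obtain ⟨a, ha⟩ := LinearMap.range_eq_top.1 htop (𝟙 X)
      rw [hφ] at ha
      have := congrArg (fun t => j ≫ t ≫ q) ha
      simp only [Category.assoc, reassoc_of% hji, zero_comp, Category.id_comp, hj] at this
      exact hB ((IsZero.iff_id_eq_zero B).2 this.symm)
    have := Submodule.finrank_lt hlt.ne
    rwa [LinearMap.finrank_range_of_inj hinj] at this
  by_cases hX : IsZero X
  · exact isFiniteSumOfSimples_of_isZero hX
  by_cases hs : Simple X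
  · exact isFiniteSumOfSimples_of_simple hs
  obtain ⟨A, i, hmono, hne, hiso⟩ : ∃ (A : C) (i : A ⟶ X), Mono i ∧ i ≠ 0 ∧ ¬ IsIso i := by
    by_contra! hcon
    refine hs ⟨fun {A} i hi => ⟨?_, fun h0 => hcon A i hi h0⟩⟩
    rintro h0 rfl
    have : Epi (0 : A ⟶ X) := inferInstance
    exact hX (IsZero.of_epi_zero A X)
  obtain ⟨p, hi⟩ := (h i).exists_retraction
  let j := kernel.ι p
  have hjp : j ≫ p = 0 := kernel.condition p
  let q : X ⟶ kernel p := kernel.lift p (𝟙 X - p ≫ i) (by simp [hi])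
  have hqj : q ≫ j = 𝟙 X - p ≫ i := kernel.lift_ι _ _ _
  have ht : p ≫ i + q ≫ j = 𝟙 X := by rw [hqj]; simp
  have hj : j ≫ q = 𝟙 _ := by
    rw [← cancel_mono j, Category.assoc, hqj]; simp [reassoc_of% hjp]
  have hiq : i ≫ q = 0 := by
    rw [← cancel_mono j, Category.assoc, hqj]; simp [reassoc_of% hi]
  have hA : ¬ IsZero A := fun hz => hne (hz.eq_of_src _ _)
  have hB : ¬ IsZero (kernel p) := fun hz => hiso ⟨p, hi, by
    rw [hz.eq_of_src j 0] at ht; simpa using ht⟩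
  exact .of_splitting i p j q hi hj hiq hjp ht
    (ih _ (key i p j q hi ht hj hjp hB) A rfl)
    (ih _ (key j q i p hj (by rw [add_comm]; exact ht) hi hiq hA) _ rfl)

end Decomposition

/-! ### Counting morphisms and isomorphism invariants -/

open Classical in
lemma sum_mul_eq_zero_of_isoClass {k : Type w} [Field k] {ι : Type*} [Fintype ι]
    {D : Type u} [Category.{v} D] (c : ι → D) (y : ι → k) (f : D → k)
    (hf : ∀ X Y, (X ≅ Y) → f X = f Y)
    (h : ∀ j, f (c j) ≠ 0 → ∑ i with Nonempty (c i ≅ c j), y i = 0) :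
    ∑ i, y i * f (c i) = 0 := by
  rw [← Finset.sum_fiberwise_of_maps_to (s := Finset.univ)
    (t := Finset.univ.image fun i =>
      (_root_.Quotient.mk _ (c i) : _root_.Quotient (isIsomorphicSetoid D)))
    (g := fun i => _root_.Quotient.mk (isIsomorphicSetoid D) (c i))
    (fun i _ => Finset.mem_image_of_mem _ (Finset.mem_univ i))]
  refine Finset.sum_eq_zero fun q hq => ?_
  obtain ⟨j, -, rfl⟩ := Finset.mem_image.1 hq
  have hiff : ∀ i, ((_root_.Quotient.mk _ (c i) : _root_.Quotient (isIsomorphicSetoid D)) =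
    _root_.Quotient.mk _ (c j)) ↔
    Nonempty (c i ≅ c j) := fun i => _root_.Quotient.eq
  simp only [hiff]
  have : ∀ i ∈ Finset.univ.filter (fun i => Nonempty (c i ≅ c j)),
      y i * f (c i) = y i * f (c j) := by
    intro i hi
    obtain ⟨e⟩ := (Finset.mem_filter.1 hi).2
    rw [hf _ _ e]
  rw [Finset.sum_congr rfl this, ← Finset.sum_mul]
  by_cases h0 : f (c j) = 0
  · rw [h0, mul_zero]
  · rw [h j h0, zero_mul]

section CountingMorphisms

variable {D : Type u} [Category.{v} D] [Abelian D]

lemma kernelSubobject_cokernel_π {X : D} (t : Subobject X) :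
    kernelSubobject (cokernel.π t.arrow) = t := by
  refine le_antisymm ?_ (le_kernelSubobject _ _ (cokernel.condition _))
  refine Subobject.le_of_comm
    (Abelian.monoLift t.arrow (kernelSubobject (cokernel.π t.arrow)).arrow (by simp)) ?_
  exact Abelian.monoLift_comp _ _ _

lemma arrow_comp_of_kernelSubobject_eq {X Y : D} {z : X ⟶ Y} {t : Subobject X}
    (h : kernelSubobject z = t) : t.arrow ≫ z = 0 := by
  subst h; simp

/-- Up to isomorphism this is the map from the coimage, which is mono in an abelian category. -/
lemma mono_cokernel_desc_of_kernelSubobject_eq {X Y : D} {z : X ⟶ Y} {t : Subobject X}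
    (h : kernelSubobject z = t) :
    Mono (cokernel.desc t.arrow z (arrow_comp_of_kernelSubobject_eq h)) := by
  subst h
  have : cokernel.desc (kernelSubobject z).arrow z (arrow_comp_of_kernelSubobject_eq rfl) =
      (cokernel.mapIso (kernelSubobject z).arrow (kernel.ι z) (kernelSubobjectIso z) (Iso.refl _)
        (by simp)).hom ≫ Abelian.factorThruCoimage z := by
    ext; simp
  rw [this]
  infer_instance

/-- Morphisms with kernel `t` are monomorphisms from the quotient by `t`. -/
noncomputable def kernelSubobjectEqEquivMono {X : D} (t : Subobject X) (Y : D) :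
    {z : X ⟶ Y // kernelSubobject z = t} ≃ {w : cokernel t.arrow ⟶ Y // Mono w} where
  toFun z := ⟨cokernel.desc t.arrow z.1 (arrow_comp_of_kernelSubobject_eq z.2),
    mono_cokernel_desc_of_kernelSubobject_eq z.2⟩
  invFun w := ⟨cokernel.π t.arrow ≫ w.1, by
    have := w.2
    rw [kernelSubobject_comp_mono, kernelSubobject_cokernel_π]⟩
  left_inv z := by simp
  right_inv w := by
    ext
    simp

lemma kernelSubobject_eq_bot_iff_mono {X Y : D} (z : X ⟶ Y) :
    kernelSubobject z = ⊥ ↔ Mono z := by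
  rw [kernelSubobject, Subobject.mk_eq_bot_iff_zero]
  refine ⟨Preadditive.mono_of_kernel_zero, fun h => ?_⟩
  rw [← cancel_mono z, kernel.condition, zero_comp]

variable {k : Type w} [Field k] {ι : Type*} [Fintype ι]

-- Sorting morphisms by kernel writes `#Hom(d, c)` as the sum of `#Mono(d/t, c)` over subobjects
-- `t`. Proper quotients are smaller, so by induction only the term `t = ⊥` survives.
open Classical in
lemma sum_mul_card_mono_eq_zero [∀ X Y : D, Finite (X ⟶ Y)] (size : D → ℕ)
    (hsize : ∀ {X Y : D} (f : X ⟶ Y), Epi f → ¬ IsIso f → size Y < size X)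
    (c : ι → D) (y : ι → k) (h : ∀ d, ∑ i, y i * (Nat.card (d ⟶ c i) : k) = 0) (d : D) :
    ∑ i, y i * (Nat.card {z : d ⟶ c i // Mono z} : k) = 0 := by
  induction hn : size d using Nat.strong_induction_on generalizing d with
  | _ n ih =>
  subst hn
  have (X Y : D) : Fintype (X ⟶ Y) := Fintype.ofFinite _
  -- The kernels that occur, with `⊥` added so that the term to be isolated is present even when no
  -- morphism is mono.
  let T : Finset (Subobject d) :=
    insert ⊥ (Finset.univ.biUnion fun i => Finset.univ.image fun z : d ⟶ c i => kernelSubobject z)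
  have hcard : ∀ i, (Nat.card (d ⟶ c i) : k) =
      ∑ t ∈ T, (Nat.card {w : cokernel t.arrow ⟶ c i // Mono w} : k) := by
    intro i
    rw [Nat.card_eq_fintype_card, ← Finset.card_univ, Finset.card_eq_sum_card_fiberwise
      (f := fun z : d ⟶ c i => kernelSubobject z) (t := T), Nat.cast_sum]
    · refine Finset.sum_congr rfl fun t _ => ?_
      rw [← Nat.card_congr (kernelSubobjectEqEquivMono t (c i)), Nat.card_eq_fintype_card,
        Fintype.card_subtype]
    · intro z _
      simp only [T, Finset.coe_insert, Set.mem_insert_iff, Finset.mem_coe, Finset.mem_biUnion,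
        Finset.mem_univ, true_and, Finset.mem_image]
      exact Or.inr ⟨i, z, rfl⟩
  have h0 := h d
  simp only [hcard, Finset.mul_sum] at h0
  rw [Finset.sum_comm, Finset.sum_eq_single_of_mem ⊥ (Finset.mem_insert_self _ _)] at h0
  · rw [← h0]
    refine Finset.sum_congr rfl fun i _ => ?_
    rw [← Nat.card_congr (kernelSubobjectEqEquivMono ⊥ (c i))]
    simp only [kernelSubobject_eq_bot_iff_mono]
  · intro t _ ht
    refine ih _ (hsize (cokernel.π t.arrow) inferInstance fun hiso => ht ?_) _ rfl
    rw [← kernelSubobject_cokernel_π t, kernelSubobject_eq_bot_iff_mono]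
    infer_instance

/-- The functions `Nat.card (d ⟶ -)` span the iso-invariant functions on a finite set of objects:
a linear relation satisfied by all of the former is satisfied by all of the latter. -/
lemma sum_mul_eq_zero_of_sum_mul_card_hom_eq_zero [CharZero k] [∀ X Y : D, Finite (X ⟶ Y)]
    (size : D → ℕ)
    (hepi : ∀ {X Y : D} (f : X ⟶ Y), Epi f → ¬ IsIso f → size Y < size X)
    (hmono : ∀ {X Y : D} (f : X ⟶ Y), Mono f → ¬ IsIso f → size X < size Y)
    (c : ι → D) (y : ι → k) (h : ∀ d, ∑ i, y i * (Nat.card (d ⟶ c i) : k) = 0)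
    (f : D → k) (hf : ∀ X Y, (X ≅ Y) → f X = f Y) :
    ∑ i, y i * f (c i) = 0 := by
  classical
  have hM := sum_mul_card_mono_eq_zero size hepi c y h
  have hinv : ∀ d X Y : D, (X ≅ Y) →
      (Nat.card {z : d ⟶ X // Mono z} : k) = Nat.card {z : d ⟶ Y // Mono z} := by
    intro d X Y e
    congr 1
    refine Nat.card_congr (Equiv.subtypeEquiv (e.homToEquiv) ?_)
    intro z
    exact ⟨fun _ => mono_comp z e.hom, fun hz =>
      have : Mono (z ≫ e.hom) := hz
      mono_of_mono z e.hom⟩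
  obtain ⟨N, hN⟩ : ∃ N, ∀ i, size (c i) < N :=
    ⟨(Finset.univ.sup fun i => size (c i)) + 1, fun i =>
      Nat.lt_succ_of_le (Finset.le_sup (f := fun i => size (c i)) (Finset.mem_univ i))⟩
  -- Descending induction on `size (c j)`: the matrix of mono counts is triangular for size, with
  -- nonzero diagonal in characteristic zero.
  have key : ∀ n j, N - size (c j) = n → ∑ i with Nonempty (c i ≅ c j), y i = 0 := by
    intro n
    induction n using Nat.strong_induction_on with
    | _ n ih =>
    rintro j rfl
    -- The mono count with the class of `c j` removed is supported, among the `c i`, on objects of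
    -- larger size, where the induction hypothesis applies.
    let g : D → k := fun X => if Nonempty (X ≅ c j) then 0 else
      (Nat.card {z : c j ⟶ X // Mono z} : k)
    have hg : ∑ i, y i * g (c i) = 0 := by
      refine sum_mul_eq_zero_of_isoClass c y g ?_ ?_
      · intro X Y e
        have : Nonempty (X ≅ c j) ↔ Nonempty (Y ≅ c j) :=
          ⟨fun ⟨t⟩ => ⟨e.symm ≪≫ t⟩, fun ⟨t⟩ => ⟨e ≪≫ t⟩⟩
        simp only [g, this, hinv _ _ _ e]
      · intro i hi
        have hni : ¬ Nonempty (c i ≅ c j) := fun hc => hi (if_pos hc)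
        have hcard : Nat.card {z : c j ⟶ c i // Mono z} ≠ 0 := fun h0 => hi (by simp [g, h0])
        obtain ⟨z, hz⟩ := (Nat.card_ne_zero.1 hcard).1
        have := hmono z hz fun hiso => hni ⟨(asIso z).symm⟩
        exact ih _ (by have := hN i; omega) i rfl
    have hsplit : ∀ i, y i * (Nat.card {z : c j ⟶ c i // Mono z} : k) = y i * g (c i) +
        (if Nonempty (c i ≅ c j) then y i else 0) *
          (Nat.card {z : c j ⟶ c j // Mono z} : k) := by
      intro i
      by_cases hc : Nonempty (c i ≅ c j)
      · obtain ⟨e⟩ := hc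
        have hc : Nonempty (c i ≅ c j) := ⟨e⟩
        simp [g, hc, hinv _ _ _ e]
      · simp [g, hc]
    have h0 := hM (c j)
    rw [Finset.sum_congr rfl fun i _ => hsplit i, Finset.sum_add_distrib, hg, zero_add,
      ← Finset.sum_mul, ← Finset.sum_filter] at h0
    refine (mul_eq_zero.1 h0).resolve_right (Nat.cast_ne_zero.2 ?_)
    exact Nat.card_ne_zero.2 ⟨⟨⟨𝟙 _, inferInstance⟩⟩, inferInstance⟩
  exact sum_mul_eq_zero_of_isoClass c y f hf fun j _ => key _ j rfl

end CountingMorphisms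

/-! ### Idempotent powers and regularity under finiteness -/

lemma exists_pow_isIdempotentElem {M : Type*} [Monoid M] [Finite M] (g : M) :
    ∃ n, 0 < n ∧ IsIdempotentElem (g ^ n) := by
  obtain ⟨a, b, hab, h⟩ := Finite.exists_ne_map_eq_of_infinite (fun n : ℕ => g ^ n)
  wlog hlt : a < b generalizing a b
  · exact this b a hab.symm h.symm (by omega)
  obtain ⟨d, rfl⟩ := Nat.exists_eq_add_of_lt hlt
  have hper : ∀ n, a ≤ n → ∀ m, g ^ (n + m * (d + 1)) = g ^ n := by
    intro n hn m
    induction m with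
    | zero => simp
    | succ m ih =>
      obtain ⟨c, rfl⟩ := Nat.exists_eq_add_of_le hn
      calc g ^ (a + c + (m + 1) * (d + 1)) = g ^ (a + d + 1) * g ^ (c + m * (d + 1)) := by
            rw [← pow_add]; congr 1; ring
        _ = g ^ a * g ^ (c + m * (d + 1)) := by rw [← h]
        _ = g ^ (a + c + m * (d + 1)) := by rw [← pow_add]; congr 1; ring
        _ = _ := ih
  -- The exponent must be positive, a multiple of the period `d + 1`, and at least the preperiod
  -- `a`.
  refine ⟨(a + 1) * (d + 1), by positivity, ?_⟩
  rw [IsIdempotentElem, ← pow_add]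
  exact hper _ (by nlinarith) _

section FiniteSemisimple

variable {E : Type u} [Category.{v} E] [Abelian E]

lemma _root_.IsSemisimpleCat.exists_iso_biproduct (hE : IsSemisimpleCat E) (X : E) :
    ∃ (n : ℕ) (S : Fin n → E) (a : ∀ i, S i ⟶ X) (r : ∀ i, X ⟶ S i), (∀ i, Simple (S i)) ∧
      ∑ i, r i ≫ a i = 𝟙 X := by
  have : HasFiniteBiproducts E := Abelian.hasFiniteBiproducts
  obtain ⟨n, S, hS, ⟨e⟩⟩ := hE X
  refine ⟨n, S, fun i => biproduct.ι S i ≫ e.inv, fun i => e.hom ≫ biproduct.π S i, hS, ?_⟩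
  have : ∀ i, (e.hom ≫ biproduct.π S i) ≫ biproduct.ι S i ≫ e.inv =
    e.hom ≫ (biproduct.π S i ≫ biproduct.ι S i) ≫ e.inv := by simp
  simp only [this]
  rw [← Preadditive.comp_sum, ← Preadditive.sum_comp, biproduct.total]
  simp

lemma exists_comp_ne_zero_of_sum_eq_id {C : Type u} [Category.{v} C] [Preadditive C] {X Y : C}
    {I J : Type*} [Fintype I] [Fintype J] {S : I → C} {T : J → C}
    {a : ∀ i, S i ⟶ X} {r : ∀ i, X ⟶ S i} {b : ∀ j, T j ⟶ Y} {s : ∀ j, Y ⟶ T j}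
    (ha : ∑ i, r i ≫ a i = 𝟙 X) (hb : ∑ j, s j ≫ b j = 𝟙 Y) {f : X ⟶ Y} (hf : f ≠ 0) :
    ∃ i j, a i ≫ f ≫ s j ≠ 0 := by
  by_contra! h
  apply hf
  have : f = (∑ i, r i ≫ a i) ≫ f ≫ (∑ j, s j ≫ b j) := by rw [ha, hb]; simp
  rw [this]
  simp only [Preadditive.sum_comp, Preadditive.comp_sum, Category.assoc]
  refine Finset.sum_eq_zero fun j _ => Finset.sum_eq_zero fun i _ => ?_
  rw [reassoc_of% (h i j)]
  simp

/-- Gaussian elimination: a nonzero matrix entry between simple objects is invertible by Schur, and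
clearing it shrinks the finite set of morphisms `v ≫ f`. -/
lemma isRegularHom_of_isSemisimpleCat (hE : IsSemisimpleCat E) (hfin : ∀ X Y : E, Finite (X ⟶ Y))
    {X Y : E} (f : X ⟶ Y) : IsRegularHom f := by
  induction hn : (Set.range fun v : X ⟶ X => v ≫ f).ncard using Nat.strong_induction_on
    generalizing f with
  | _ n ih =>
  subst hn
  by_cases hf : f = 0
  · exact ⟨0, by simp [hf]⟩
  obtain ⟨n, S, a, r, hS, ha⟩ := hE.exists_iso_biproduct X
  obtain ⟨m, T, b, s, hT, hb⟩ := hE.exists_iso_biproduct Y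
  obtain ⟨i, j, hij⟩ := exists_comp_ne_zero_of_sum_eq_id ha hb hf
  have := hS i
  have := hT j
  have := isIso_of_hom_simple hij
  let t := s j ≫ inv (a i ≫ f ≫ s j)
  have ht : a i ≫ f ≫ t = 𝟙 _ := by
    have := IsIso.hom_inv_id (a i ≫ f ≫ s j)
    simpa [t, -IsIso.hom_inv_id, -IsIso.inv_comp] using this
  have ht0 : (f - f ≫ t ≫ a i ≫ f) ≫ t = 0 := by simp [ht]
  -- The new range lies in the old one but misses `(f ≫ t ≫ a i) ≫ f`: composition with `t` kills
  -- the new range and sends this element to `f ≫ t`, which is nonzero.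
  refine .of_sub (t ≫ a i) (ih _ (Set.ncard_lt_ncard ⟨?_, ?_⟩ (Set.toFinite _)) _ rfl)
  · rintro _ ⟨v, rfl⟩
    exact ⟨v ≫ (𝟙 X - f ≫ t ≫ a i), by simp⟩
  · intro hsub
    obtain ⟨v, hv⟩ := hsub ⟨f ≫ t ≫ a i, rfl⟩
    have h1 := congrArg (fun z => z ≫ t) hv
    simp only [Category.assoc, ht0, comp_zero, ht, Category.comp_id] at h1
    apply id_nonzero (S i)
    rw [← ht, ← h1, comp_zero]

/-- `End X` embeds as a corner of `End Y` that misses the identity. This makes the cardinality of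
`End` a strict measure of size. -/
lemma natCard_end_lt_of_retract {C : Type u} [Category.{v} C] {X Y : C} [Finite (Y ⟶ Y)]
    (i : X ⟶ Y) (r : Y ⟶ X) (h : i ≫ r = 𝟙 X) (hne : r ≫ i ≠ 𝟙 Y) :
    Nat.card (X ⟶ X) < Nat.card (Y ⟶ Y) := by
  have hinj : Function.Injective fun v : X ⟶ X => r ≫ v ≫ i := by
    intro a b hab
    have := congrArg (fun z => i ≫ z ≫ r) hab
    simpa [h, reassoc_of% h] using this
  have hns : ¬ Function.Surjective fun v : X ⟶ X => r ≫ v ≫ i := by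
    intro hs
    obtain ⟨v, hv⟩ := hs (𝟙 Y)
    simp only at hv
    apply hne
    have : v = 𝟙 X := by
      have h1 := congrArg (fun z => i ≫ z ≫ r) hv
      simpa [h, reassoc_of% h] using h1
    simpa [this] using hv
  have := Fintype.ofFinite (Y ⟶ Y)
  have := Finite.of_injective _ hinj
  have := Fintype.ofFinite (X ⟶ X)
  rw [Nat.card_eq_fintype_card, Nat.card_eq_fintype_card]
  exact Fintype.card_lt_of_injective_not_surjective _ hinj hns

end FiniteSemisimple

/-! ### Objects with an automorphism and Fitting's decomposition -/

section Automorphisms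

variable {E : Type u} [Category.{v} E]

/-- The automorphism underlying an action of the infinite cyclic group. -/
def actionGen (A : Action E (Multiplicative ℤ)) : A.V ⟶ A.V := A.ρ (.ofAdd 1)

/-- The inverse of `actionGen A`. -/
def actionGenInv (A : Action E (Multiplicative ℤ)) : A.V ⟶ A.V := A.ρ (.ofAdd (-1))

lemma action_ρ_comp {G : Type*} [CommMonoid G] (A : Action E G) (a b : G) :
    (A.ρ a ≫ A.ρ b : A.V ⟶ A.V) = A.ρ (a * b) := by
  rw [mul_comm, map_mul]; rfl

@[simp]
lemma actionGen_comp_actionGenInv (A : Action E (Multiplicative ℤ)) :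
    actionGen A ≫ actionGenInv A = 𝟙 _ := by
  rw [actionGen, actionGenInv, action_ρ_comp]
  simp

@[simp]
lemma actionGenInv_comp_actionGen (A : Action E (Multiplicative ℤ)) :
    actionGenInv A ≫ actionGen A = 𝟙 _ := by
  rw [actionGen, actionGenInv, action_ρ_comp]
  simp

@[simp]
lemma actionGen_comp_actionGenInv_assoc (A : Action E (Multiplicative ℤ)) {Z : E} (z : A.V ⟶ Z) :
    actionGen A ≫ actionGenInv A ≫ z = z := by
  rw [← Category.assoc, actionGen_comp_actionGenInv, Category.id_comp]

@[simp]
lemma actionGenInv_comp_actionGen_assoc (A : Action E (Multiplicative ℤ)) {Z : E} (z : A.V ⟶ Z) :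
    actionGenInv A ≫ actionGen A ≫ z = z := by
  rw [← Category.assoc, actionGenInv_comp_actionGen, Category.id_comp]

lemma action_comm_of_actionGen {A B : Action E (Multiplicative ℤ)} (z : A.V ⟶ B.V)
    (h : actionGen A ≫ z = z ≫ actionGen B) (g : Multiplicative ℤ) :
    A.ρ g ≫ z = z ≫ B.ρ g := by
  have hinv : actionGenInv A ≫ z = z ≫ actionGenInv B := by
    calc actionGenInv A ≫ z = actionGenInv A ≫ (z ≫ actionGen B) ≫ actionGenInv B := by simp
      _ = z ≫ actionGenInv B := by rw [← h]; simp
  have hmul : ∀ a b, A.ρ a ≫ z = z ≫ B.ρ a → A.ρ b ≫ z = z ≫ B.ρ b →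
      A.ρ (a * b) ≫ z = z ≫ B.ρ (a * b) := by
    intro a b ha hb
    rw [← action_ρ_comp, ← action_ρ_comp, Category.assoc, hb, ← Category.assoc, ha, Category.assoc]
  have key : ∀ n : ℤ, A.ρ (.ofAdd n) ≫ z = z ≫ B.ρ (.ofAdd n) := by
    intro n
    induction n using Int.induction_on with
    | zero => simp
    | succ n ih => rw [ofAdd_add]; exact hmul _ _ ih h
    | pred n ih => rw [sub_eq_add_neg, ofAdd_add]; exact hmul _ _ ih hinv
  exact key g.toAdd

/-- The action of the infinite cyclic group given by an automorphism. -/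
def actionOfInv {X : E} (h h' : X ⟶ X) (h1 : h ≫ h' = 𝟙 X) (h2 : h' ≫ h = 𝟙 X) :
    Action E (Multiplicative ℤ) where
  V := X
  ρ := (Units.coeHom (End X)).comp (zpowersHom (End X)ˣ ⟨h, h', h2, h1⟩)

lemma actionGen_actionOfInv {X : E} (h h' : X ⟶ X) (h1 : h ≫ h' = 𝟙 X) (h2 : h' ≫ h = 𝟙 X) :
    actionGen (actionOfInv h h' h1 h2) = h := by
  change ((zpowersHom (End X)ˣ ⟨h, h', h2, h1⟩ (.ofAdd 1) : (End X)ˣ) : End X) = h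
  rw [zpowersHom_apply]
  simp

/-- Fitting's decomposition: the part on which an endomorphism of an object is invertible. -/
lemma exists_invertiblePart [IsIdempotentComplete E] {X : E} [Finite (X ⟶ X)] (g : X ⟶ X) :
    ∃ (B : Action E (Multiplicative ℤ)) (i : B.V ⟶ X) (p : X ⟶ B.V) (n : ℕ), 0 < n ∧
      i ≫ p = 𝟙 _ ∧ p ≫ i = (End.of g ^ n : End X) ∧ i ≫ g = actionGen B ≫ i := by
  have : Finite (End X) := ‹Finite (X ⟶ X)›
  obtain ⟨n, hn, hidem⟩ := exists_pow_isIdempotentElem (End.of g)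
  obtain ⟨n, rfl⟩ := Nat.exists_eq_add_one.2 hn
  let e : X ⟶ X := (End.of g ^ (n + 1) : End X)
  -- On the image of the idempotent `g ^ (n + 1)`, the power `g ^ n` is inverse to `g`.
  let f : X ⟶ X := (End.of g ^ n : End X)
  have hge : g ≫ e = e ≫ g := (pow_mul_comm' (End.of g) (n + 1))
  have hfe : f ≫ e = e ≫ f := (pow_mul_comm (End.of g) (n + 1) n)
  have hgf : g ≫ f = e := (pow_succ (End.of g) n).symm
  have hfg : f ≫ g = e := (pow_succ' (End.of g) n).symm
  obtain ⟨Y, i, p, hi, hp⟩ := IsIdempotentComplete.idempotents_split X e hidem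
  have hie : i ≫ e = i := by rw [← hp, reassoc_of% hi]
  have hep : e ≫ p = p := by rw [← hp, Category.assoc, hi, Category.comp_id]
  have h1 : (i ≫ g ≫ p) ≫ i ≫ f ≫ p = 𝟙 Y := by
    have : (i ≫ g ≫ p) ≫ i ≫ f ≫ p = i ≫ g ≫ (p ≫ i) ≫ f ≫ p := by simp
    rw [this, hp, reassoc_of% hge, reassoc_of% hie, reassoc_of% hgf, hep, hi]
  have h2 : (i ≫ f ≫ p) ≫ i ≫ g ≫ p = 𝟙 Y := by
    have : (i ≫ f ≫ p) ≫ i ≫ g ≫ p = i ≫ f ≫ (p ≫ i) ≫ g ≫ p := by simp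
    rw [this, hp, reassoc_of% hfe, reassoc_of% hie, reassoc_of% hfg, hep, hi]
  refine ⟨actionOfInv _ _ h1 h2, i, p, n + 1, hn, hi, hp, ?_⟩
  rw [actionGen_actionOfInv]
  have : (i ≫ g ≫ p) ≫ i = i ≫ g ≫ (p ≫ i) := by simp
  exact (this.trans (by rw [hp, hge, reassoc_of% hie]; rfl)).symm

/-- Intertwiners from an automorphism to an endomorphism land in its invertible part. -/
def homInvertiblePartEquiv {X : E} {g : X ⟶ X} {B : Action E (Multiplicative ℤ)} {i : B.V ⟶ X}
    {p : X ⟶ B.V} {n : ℕ} (hi : i ≫ p = 𝟙 _) (hp : p ≫ i = (End.of g ^ n : End X))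
    (hg : i ≫ g = actionGen B ≫ i) (A : Action E (Multiplicative ℤ)) :
    (A ⟶ B) ≃ {z : A.V ⟶ X // actionGenInv A ≫ z ≫ g = z} := by
  -- Iterating the fixed-point equation `n` times factors `z` through the idempotent `g ^ n`, hence
  -- through the invertible part.
  have hpow : ∀ (z : A.V ⟶ X), actionGenInv A ≫ z ≫ g = z → ∃ t : A.V ⟶ A.V,
      t ≫ z ≫ (End.of g ^ n : End X) = z := by
    intro z hz
    clear hp
    induction n with
    | zero => exact ⟨𝟙 _, by simp⟩
    | succ n ih =>
      obtain ⟨t, ht⟩ := ih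
      refine ⟨actionGenInv A ≫ t, ?_⟩
      have : (End.of g ^ (n + 1) : End X) = (End.of g ^ n : End X) ≫ g := pow_succ' _ _
      rw [this]
      have h3 : (actionGenInv A ≫ t) ≫ z ≫ (End.of g ^ n : End X) ≫ g =
        actionGenInv A ≫ (t ≫ z ≫ (End.of g ^ n : End X)) ≫ g := by simp
      rw [h3, ht, hz]
  have hpi : ∀ (z : A.V ⟶ X), actionGenInv A ≫ z ≫ g = z → z ≫ p ≫ i = z := by
    intro z hz
    obtain ⟨t, ht⟩ := hpow z hz
    rw [← hp] at ht
    rw [← ht]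
    simp [reassoc_of% hi]
  exact {
    toFun := fun w => ⟨w.hom ≫ i, by
      have := w.comm (.ofAdd 1)
      change actionGen A ≫ w.hom = w.hom ≫ actionGen B at this
      rw [Category.assoc, hg, ← reassoc_of% this]
      simp⟩
    invFun := fun z => ⟨z.1 ≫ p, action_comm_of_actionGen _ (by
      have h1 : actionGen A ≫ z.1 = z.1 ≫ g := by
        conv_lhs => rw [← z.2]
        simp
      have h2 : g ≫ p ≫ i = p ≫ i ≫ g := by
        have := (pow_mul_comm' (End.of g) n)
        rw [← Category.assoc p, hp]
        exact this
      calc actionGen A ≫ z.1 ≫ p = z.1 ≫ g ≫ p := by rw [reassoc_of% h1]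
        _ = z.1 ≫ (g ≫ p ≫ i) ≫ p := by simp [hi]
        _ = z.1 ≫ p ≫ (i ≫ g) ≫ p := by rw [h2]; simp
        _ = (z.1 ≫ p) ≫ actionGen B := by rw [hg]; simp [hi])⟩
    left_inv := fun w => by
      ext
      simp [hi]
    right_inv := fun z => by
      ext
      simpa using hpi z.1 z.2 }

end Automorphisms

/-! ### Traces on linearized Hom spaces -/

section FreeTrace

variable (k : Type w) [Field k] {E : Type u} [Category.{v} E]

/-- In the standard basis each fixed point contributes a diagonal entry `1`, and every other
diagonal entry is `0`. -/
lemma trace_lmapDomain {α : Type*} [Finite α] (σ : α → α) :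
    LinearMap.trace k (α →₀ k) (Finsupp.lmapDomain k k σ) = Nat.card {a // σ a = a} := by
  classical
  have := Fintype.ofFinite α
  rw [LinearMap.trace_eq_matrix_trace k Finsupp.basisSingleOne, Matrix.trace,
    Nat.card_eq_fintype_card, Fintype.card_subtype, ← Finset.sum_boole]
  refine Finset.sum_congr rfl fun a _ => ?_
  simp [LinearMap.toMatrix_apply, Finsupp.single_apply]

/-- A morphism of `E`, as a morphism of the linearization. -/
noncomputable def Free.ofHom {X Y : E} (f : X ⟶ Y) : Free.of k X ⟶ Free.of k Y :=
  (Free.embedding k E).map f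

lemma Free.ofHom_comp {X Y Z : E} (f : X ⟶ Y) (g : Y ⟶ Z) :
    Free.ofHom k (f ≫ g) = Free.ofHom k f ≫ Free.ofHom k g :=
  (Free.embedding k E).map_comp f g

lemma Free.ofHom_id (X : E) : Free.ofHom k (𝟙 X) = 𝟙 (Free.of k X) :=
  (Free.embedding k E).map_id X

variable {k}

lemma Free.hom_induction {X Y : E} {P : (Free.of k X ⟶ Free.of k Y) → Prop}
    (h0 : P 0) (hadd : ∀ x y, P x → P y → P (x + y))
    (hsingle : ∀ (c : k) (f : X ⟶ Y), P (c • Free.ofHom k f)) (x : Free.of k X ⟶ Free.of k Y) :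
    P x := by
  refine Finsupp.induction_linear (motive := P) x h0 hadd fun f c => ?_
  have := hsingle c f
  convert this
  exact (Finsupp.smul_single_one f c).symm

/-- The operator `z ↦ h ≫ z ≫ x`. -/
noncomputable def sandwich {X Z : E} (h : Z ⟶ Z) :
    (Free.of k X ⟶ Free.of k X) →ₗ[k] Module.End k (Free.of k Z ⟶ Free.of k X) where
  toFun x := Linear.rightComp k _ x ∘ₗ Linear.leftComp k _ (Free.ofHom k h)
  map_add' x y := by ext z; simp
  map_smul' c x := by ext z; simp

lemma sandwich_apply {X Z : E} (h : Z ⟶ Z) (x : Free.of k X ⟶ Free.of k X)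
    (z : Free.of k Z ⟶ Free.of k X) : sandwich h x z = Free.ofHom k h ≫ z ≫ x :=
  Category.assoc (Free.ofHom k h) z x

lemma trace_sandwich_ofHom {X Z : E} [Finite (Z ⟶ X)] (h : Z ⟶ Z) (g : X ⟶ X) :
    LinearMap.trace k _ (sandwich h (Free.ofHom k g)) = Nat.card {z : Z ⟶ X // h ≫ z ≫ g = z} := by
  rw [← trace_lmapDomain k (fun z : Z ⟶ X => h ≫ z ≫ g)]
  have : sandwich h (Free.ofHom k g) = (Finsupp.lmapDomain k k (fun z : Z ⟶ X => h ≫ z ≫ g) :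
      ((Z ⟶ X) →₀ k) →ₗ[k] ((Z ⟶ X) →₀ k)) := by
    refine LinearMap.ext fun z => ?_
    induction z using Free.hom_induction with
    | h0 => rw [map_zero]; exact (map_zero _).symm
    | hadd x y hx hy => rw [map_add, hx, hy]; exact (map_add _ _ _).symm
    | hsingle c f =>
      rw [map_smul, sandwich_apply, ← Free.ofHom_comp, ← Free.ofHom_comp]
      refine Eq.trans ?_ (map_smul (Finsupp.lmapDomain k k (fun z : Z ⟶ X => h ≫ z ≫ g)) c
        (Finsupp.single f 1)).symm
      erw [Finsupp.lmapDomain_apply, Finsupp.mapDomain_single]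
      rfl
  rw [this]
  rfl

lemma trace_sandwich {X Z : E} [Finite (Z ⟶ X)] [Fintype (X ⟶ X)] (h : Z ⟶ Z)
    (x : (X ⟶ X) →₀ k) :
    LinearMap.trace k _ (sandwich (k := k) h x) =
      ∑ g, x g * (Nat.card {z : Z ⟶ X // h ≫ z ≫ g = z} : k) := by
  have hx : x = ∑ g, x g • (Free.ofHom k g : (X ⟶ X) →₀ k) := by
    conv_lhs => rw [← Finsupp.univ_sum_single x]
    exact Finset.sum_congr rfl fun g _ => (Finsupp.smul_single_one g _).symm
  have h2 : sandwich (k := k) h x = ∑ g, x g • sandwich h (Free.ofHom k g) := by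
    conv_lhs => rw [hx]
    erw [map_sum]
    exact Finset.sum_congr rfl fun g _ => map_smul _ _ _
  rw [h2, map_sum]
  exact Finset.sum_congr rfl fun g _ => by rw [map_smul, trace_sandwich_ofHom, smul_eq_mul]

/-- Pre- and postcomposition commute, so the `m`-th power is `z ↦ h ^ m ≫ z ≫ x ^ m`. -/
lemma isNilpotent_sandwich {X Z : E} (h : Z ⟶ Z) (x : End (Free.of k X)) (hx : IsNilpotent x) :
    IsNilpotent (sandwich (k := k) h x) := by
  obtain ⟨n, hn⟩ := hx
  have : ∀ (m : ℕ) (z : Free.of k Z ⟶ Free.of k X), (sandwich (k := k) h x ^ m) z =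
      Free.ofHom k (End.of h ^ m : End Z) ≫ z ≫ (x ^ m : End (Free.of k X)) := by
    intro m
    induction m with
    | zero => intro z; simp [Free.ofHom_id]
    | succ m ih =>
      intro z
      rw [pow_succ', Module.End.mul_apply, ih, sandwich_apply]
      have h1 : (End.of h ^ (m + 1) : End Z) = h ≫ (End.of h ^ m : End Z) := pow_succ _ _
      have h2 : (x ^ (m + 1) : End (Free.of k X)) = (x ^ m : End (Free.of k X)) ≫ x := pow_succ' _ _
      rw [h1, h2, Free.ofHom_comp]
      simp only [Category.assoc]
  refine ⟨n, LinearMap.ext fun z => ?_⟩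
  rw [this, hn]
  exact (congrArg _ comp_zero).trans comp_zero

end FreeTrace

/-! ### Additive characters from traces -/

section TraceCharacter

variable {E : Type u} [Category.{v} E] [Abelian E]

/-- A simple object `S` with finite endomorphism ring defines additive characters of all finite
endomorphism groups, through the trace over the field `End S` on `Hom(S, -)`. -/
lemma exists_traceCharacter (k : Type w) [Field k] [IsAlgClosed k] [CharZero k]
    (hfin : ∀ X Y : E, Finite (X ⟶ Y)) (S : E) (hS : Simple S) :
    ∃ χ : ∀ X : E, AddChar (X ⟶ X) k,
      (∀ (X Y : E) (a : X ⟶ Y) (b : Y ⟶ X), χ X (a ≫ b) = χ Y (b ≫ a)) ∧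
      (∀ (X : E) (g : X ⟶ X), IsNilpotent (End.of g) → χ X g = 1) ∧
      (∀ (X : E), (∀ f : S ⟶ X, f = 0) → ∀ g, χ X g = 1) ∧ ∃ c : S ⟶ S, χ S c ≠ 1 := by
  have : Finite (End S) := hfin S S
  let D := End S
  let : Field D := littleWedderburn (End S)
  have hcomm : ∀ c d : S ⟶ S, c ≫ d = d ≫ c := fun c d => mul_comm (G := D) d c
  -- Commutativity of `D`, from Wedderburn's theorem, turns precomposition into a left action and
  -- makes a trace over `D` available.
  let (X : E) : Module D (S ⟶ X) :=
    { smul := fun d z => End.asHom d ≫ z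
      one_smul := fun z => Category.id_comp z
      mul_smul := fun c d z => by
        change (End.asHom d ≫ End.asHom c) ≫ z = End.asHom c ≫ End.asHom d ≫ z
        rw [hcomm, Category.assoc]
      smul_zero := fun d => comp_zero
      smul_add := fun d z z' => Preadditive.comp_add _ _ _ _ _ _
      add_smul := fun c d z => Preadditive.add_comp _ _ _ _ _ _
      zero_smul := fun z => zero_comp }
  have hsmul : ∀ (X : E) (d : D) (z : S ⟶ X), d • z = End.asHom d ≫ z := fun _ _ _ => rfl
  have (X : E) : Module.Finite D (S ⟶ X) := have := hfin S X; Module.Finite.of_finite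
  let post (X Y : E) (a : X ⟶ Y) : (S ⟶ X) →ₗ[D] (S ⟶ Y) :=
    { toFun := fun z => z ≫ a
      map_add' := fun z z' => Preadditive.add_comp _ _ _ _ _ _
      map_smul' := fun d z => Category.assoc _ _ _ }
  have hpost : ∀ (X Y Z : E) (a : X ⟶ Y) (b : Y ⟶ Z), post X Z (a ≫ b) = post Y Z b ∘ₗ post X Y a :=
    fun X Y Z a b => LinearMap.ext fun z => (Category.assoc z a b).symm
  let t (X : E) : (X ⟶ X) →+ D :=
    { toFun := fun g => LinearMap.trace D (S ⟶ X) (post X X g)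
      map_zero' := by
        have : post X X 0 = 0 := LinearMap.ext fun z => comp_zero
        rw [this, map_zero]
      map_add' := fun g g' => by
        have : post X X (g + g') = post X X g + post X X g' :=
          LinearMap.ext fun z => Preadditive.comp_add _ _ _ _ _ _
        rw [this, map_add] }
  -- Roots of unity in `k` supply a character of the finite additive group `D` that is nontrivial at
  -- `1`.
  obtain ⟨φ, hφ⟩ := CommGroup.exists_apply_ne_one_of_hasEnoughRootsOfUnity (Multiplicative D) k
    (a := .ofAdd (1 : D)) (fun h => one_ne_zero (α := D) h)
  let ψ : AddChar D k := AddChar.toMonoidHomEquiv.symm ((Units.coeHom k).comp φ)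
  have hψ : ψ 1 ≠ 1 := fun h => hφ (Units.ext h)
  refine ⟨fun X => ψ.compAddMonoidHom (t X), ?_, ?_, ?_, 𝟙 S, ?_⟩
  · intro X Y a b
    have : t X (a ≫ b) = t Y (b ≫ a) := by
      change LinearMap.trace D _ (post X X (a ≫ b)) = LinearMap.trace D _ (post Y Y (b ≫ a))
      rw [hpost, hpost, LinearMap.trace_comp_comm']
    rw [AddChar.compAddMonoidHom_apply, AddChar.compAddMonoidHom_apply, this]
  · rintro X g ⟨n, hn⟩
    have hpow : ∀ m, post X X g ^ m = post X X (End.of g ^ m : End X) := by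
      intro m
      induction m with
      | zero => exact LinearMap.ext fun z => (Category.comp_id z).symm
      | succ m ih =>
        rw [pow_succ, ih]
        exact (hpost X X X g (End.of g ^ m : End X)).symm
    have hnil : IsNilpotent (post X X g) :=
      ⟨n, by rw [hpow, hn]; exact LinearMap.ext fun z => comp_zero⟩
    have : t X g = 0 := (LinearMap.isNilpotent_trace_of_isNilpotent hnil).eq_zero
    rw [AddChar.compAddMonoidHom_apply, this, AddChar.map_zero_eq_one]
  · intro X hX g
    have h0 : post X X g = 0 := LinearMap.ext fun z => hX _
    have : t X g = 0 := by
      change LinearMap.trace D _ (post X X g) = 0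
      rw [h0, map_zero]
    rw [AddChar.compAddMonoidHom_apply, this, AddChar.map_zero_eq_one]
  · have h1 : post S S (𝟙 S) = 1 := LinearMap.ext fun z => Category.comp_id z
    have hrank : Module.finrank D (S ⟶ S) = 1 :=
      finrank_eq_one (𝟙 S) (id_nonzero S) fun z => ⟨z, Category.comp_id z⟩
    have : t S (𝟙 S) = 1 := by
      change LinearMap.trace D _ (post S S (𝟙 S)) = 1
      rw [h1, LinearMap.trace_one, hrank, Nat.cast_one]
    rw [AddChar.compAddMonoidHom_apply, this]
    exact hψ

/-- On a finite semi-simple category, there are characters of all endomorphism groups with the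
formal properties of a trace, which are nondegenerate on a given object. -/
lemma exists_nondegenerate_traceCharacter (k : Type w) [Field k] [IsAlgClosed k] [CharZero k]
    (hE : IsSemisimpleCat E) (hfin : ∀ X Y : E, Finite (X ⟶ Y)) (X : E) :
    ∃ χ : ∀ Y : E, AddChar (Y ⟶ Y) k,
      (∀ (Y Z : E) (a : Y ⟶ Z) (b : Z ⟶ Y), χ Y (a ≫ b) = χ Z (b ≫ a)) ∧
      (∀ (Y : E) (g : Y ⟶ Y), IsNilpotent (End.of g) → χ Y g = 1) ∧
      (∀ f : X ⟶ X, f ≠ 0 → ∃ b, χ X (f ≫ b) ≠ 1) := by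
  classical
  obtain ⟨n, S, a, r, hS, ha⟩ := hE.exists_iso_biproduct X
  choose χ hcyc hnil hzero hne using fun T : {T : E // Simple T} =>
    exists_traceCharacter k hfin T.1 T.2
  let s : Setoid {T : E // Simple T} := (isIsomorphicSetoid E).comap Subtype.val
  let rep (i : Fin n) : {T : E // Simple T} := (_root_.Quotient.mk s ⟨S i, hS i⟩).out
  have hrep : ∀ i, Nonempty ((rep i).1 ≅ S i) := fun i =>
    _root_.Quotient.mk_out (s := s) ⟨S i, hS i⟩
  have hrep' : ∀ i j, Nonempty ((rep i).1 ≅ (rep j).1) → rep i = rep j := fun i j ⟨e⟩ => by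
    obtain ⟨e1⟩ := hrep i
    obtain ⟨e2⟩ := hrep j
    exact congrArg _root_.Quotient.out (_root_.Quotient.sound (s := s) ⟨e1.symm ≪≫ e ≪≫ e2⟩)
  -- Each isomorphism class of simple constituents is used once: repeated factors could cancel. The
  -- sum of additive characters below is their pointwise product.
  let F : Finset {T : E // Simple T} := Finset.univ.image rep
  refine ⟨fun Y => ∑ T ∈ F, χ T Y, ?_, ?_, ?_⟩
  · intro Y Z u v
    rw [AddChar.sum_apply, AddChar.sum_apply]
    exact Finset.prod_congr rfl fun T _ => hcyc T _ _ _ _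
  · intro Y g hg
    rw [AddChar.sum_apply]
    exact Finset.prod_eq_one fun T _ => hnil T _ _ hg
  · intro f hf
    obtain ⟨i, j, hij⟩ := exists_comp_ne_zero_of_sum_eq_id ha ha hf
    have := hS i
    have := hS j
    have := isIso_of_hom_simple hij
    obtain ⟨e⟩ := hrep i
    let t := r j ≫ inv (a i ≫ f ≫ r j)
    have ht : a i ≫ f ≫ t = 𝟙 _ := by
      have := IsIso.hom_inv_id (a i ≫ f ≫ r j)
      simpa [t, -IsIso.hom_inv_id, -IsIso.inv_comp] using this
    obtain ⟨c, hc⟩ := hne (rep i)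
    -- With this choice, cyclicity reduces the value at `f ≫ b` to the value at `c` on one simple
    -- object, where only its own class contributes.
    refine ⟨t ≫ e.inv ≫ c ≫ e.hom ≫ a i, ?_⟩
    rw [AddChar.sum_apply]
    have hT : ∀ T, χ T X (f ≫ t ≫ e.inv ≫ c ≫ e.hom ≫ a i) = χ T _ c := by
      intro T
      have h1 := hcyc T _ _ (f ≫ t ≫ e.inv ≫ c) (e.hom ≫ a i)
      simp only [Category.assoc] at h1
      rw [h1, reassoc_of% ht]
      simp
    rw [Finset.prod_congr rfl fun T _ => hT T,
      Finset.prod_eq_single_of_mem (rep i) (Finset.mem_image_of_mem _ (Finset.mem_univ i))]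
    · exact hc
    · intro T hTF hTne
      obtain ⟨l, -, rfl⟩ := Finset.mem_image.1 hTF
      refine hzero _ _ (fun z => ?_) _
      by_contra hz
      have := (rep i).2
      have := (rep l).2
      have := isIso_of_hom_simple hz
      exact hTne (hrep' _ _ ⟨asIso z⟩)

end TraceCharacter

/-! ### Characters vanish on nilpotents -/

section NilpotentVanishing

variable {E : Type u} [Category.{v} E] [Abelian E]

/-- The counting argument applies with size `#End` of the underlying object, since monos and epis
split in `E` after the automorphism is forgotten. -/
lemma action_sum_mul_eq_zero {k : Type w} [Field k] [CharZero k] {ι : Type*} [Fintype ι]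
    (hE : IsSemisimpleCat E) (hfin : ∀ X Y : E, Finite (X ⟶ Y))
    (c : ι → Action E (Multiplicative ℤ)) (y : ι → k)
    (h : ∀ d, ∑ i, y i * (Nat.card (d ⟶ c i) : k) = 0) (f : Action E (Multiplicative ℤ) → k)
    (hf : ∀ A B, (A ≅ B) → f A = f B) : ∑ i, y i * f (c i) = 0 := by
  have (A B : Action E (Multiplicative ℤ)) : Finite (A ⟶ B) :=
    have := hfin A.V B.V
    Finite.of_injective _ Action.hom_injective
  refine sum_mul_eq_zero_of_sum_mul_card_hom_eq_zero (fun A => Nat.card (A.V ⟶ A.V))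
    ?_ ?_ c y h f hf
  · intro A B z hz hiso
    have : Epi z.hom := inferInstanceAs (Epi ((Action.forget E _).map z))
    obtain ⟨s, hs⟩ := (isRegularHom_of_isSemisimpleCat hE hfin z.hom).exists_section
    refine natCard_end_lt_of_retract s z.hom hs fun h => hiso ?_
    have : IsIso z.hom := ⟨s, h, hs⟩
    exact Action.isIso_of_hom_isIso z
  · intro A B z hz hiso
    have : Mono z.hom := inferInstanceAs (Mono ((Action.forget E _).map z))
    obtain ⟨s, hs⟩ := (isRegularHom_of_isSemisimpleCat hE hfin z.hom).exists_retraction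
    refine natCard_end_lt_of_retract z.hom s hs fun h => hiso ?_
    have : IsIso z.hom := ⟨s, hs, h⟩
    exact Action.isIso_of_hom_isIso z

/-- A trace-like character vanishes on nilpotent elements of the monoid algebra of `End X`. -/
lemma sum_mul_traceCharacter_eq_zero {k : Type w} [Field k] [CharZero k]
    (hE : IsSemisimpleCat E) (hfin : ∀ X Y : E, Finite (X ⟶ Y))
    (χ : ∀ Y : E, AddChar (Y ⟶ Y) k)
    (hcyc : ∀ (Y Z : E) (a : Y ⟶ Z) (b : Z ⟶ Y), χ Y (a ≫ b) = χ Z (b ≫ a))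
    (hnil : ∀ (Y : E) (g : Y ⟶ Y), IsNilpotent (End.of g) → χ Y g = 1)
    {X : E} [Fintype (X ⟶ X)] (x : (X ⟶ X) →₀ k)
    (hx : IsNilpotent (show End (Free.of k X) from x)) : ∑ g, x g * χ X g = 0 := by
  choose B i p n hn hi hp hg using fun g : X ⟶ X => exists_invertiblePart g
  have h0 := action_sum_mul_eq_zero hE hfin B x ?_ (fun A => χ A.V (actionGen A)) ?_
  · rw [← h0]
    refine Finset.sum_congr rfl fun g _ => ?_
    congr 1
    have hge : g ≫ p g ≫ i g = p g ≫ i g ≫ g := by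
      have := pow_mul_comm' (End.of g) (n g)
      rw [← Category.assoc (p g), hp]
      exact this
    have h1 : χ (B g).V (actionGen (B g)) = χ X (g ≫ p g ≫ i g) := by
      have : actionGen (B g) = (i g ≫ g) ≫ p g := by rw [hg]; simp [hi]
      rw [this, Category.assoc, hcyc, Category.assoc]
    -- Fitting: `g` is its invertible part plus a nilpotent part, and the character is `1` on the
    -- latter.
    have h2 : g = g ≫ p g ≫ i g + (g - g ≫ p g ≫ i g) := by abel
    have h3 : IsNilpotent (End.of (g - g ≫ p g ≫ i g)) := by
      have he : IsIdempotentElem (End.of (p g ≫ i g)) := by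
        change (p g ≫ i g) ≫ p g ≫ i g = p g ≫ i g
        simp [reassoc_of% (hi g)]
      have hc : Commute (End.of g) (1 - End.of (p g ≫ i g)) :=
        Commute.sub_right (Commute.one_right _)
          (show (p g ≫ i g) ≫ g = g ≫ p g ≫ i g by rw [hge, Category.assoc])
      have h4 : End.of (g - g ≫ p g ≫ i g) = End.of g * (1 - End.of (p g ≫ i g)) := by
        rw [hc.eq]
        change _ = g ≫ (𝟙 X - p g ≫ i g)
        simp
      refine ⟨n g, ?_⟩
      rw [h4, hc.mul_pow, he.one_sub.pow_eq (hn g).ne', ← hp, mul_sub, mul_one]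
      exact sub_eq_zero.2 he.symm
    rw [h1]
    conv_lhs => rw [h2]
    rw [AddChar.map_add_eq_mul, hnil _ _ h3, mul_one]
  · intro A
    have hT := trace_sandwich (actionGenInv A) x
    rw [(LinearMap.isNilpotent_trace_of_isNilpotent
      (isNilpotent_sandwich (actionGenInv A) _ hx)).eq_zero] at hT
    rw [hT]
    refine Finset.sum_congr rfl fun g _ => ?_
    rw [Nat.card_congr (homInvertiblePartEquiv (hi g) (hp g) (hg g) A)]
  · intro A C e
    have h1 : actionGen A ≫ e.hom.hom = e.hom.hom ≫ actionGen C := e.hom.comm (.ofAdd 1)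
    have h2 : e.hom.hom ≫ e.inv.hom = 𝟙 _ := congrArg Action.Hom.hom e.hom_inv_id
    have h3 : e.inv.hom ≫ e.hom.hom = 𝟙 _ := congrArg Action.Hom.hom e.inv_hom_id
    have h4 : actionGen A = e.hom.hom ≫ actionGen C ≫ e.inv.hom := by
      rw [← reassoc_of% h1, h2, Category.comp_id]
    rw [h4, hcyc, Category.assoc, h3, Category.comp_id]

end NilpotentVanishing

/-! ### Semi-simplicity of the endomorphism algebras -/

section SemisimpleEnd

variable {k : Type w} [Field k] {E : Type u} [Category.{v} E]

instance finiteDimensional_free_hom [∀ X Y : E, Finite (X ⟶ Y)] (X Y : Free k E) :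
    FiniteDimensional k (X ⟶ Y) := by
  have : Finite ((show E from X) ⟶ (show E from Y)) := inferInstance
  exact inferInstanceAs (FiniteDimensional k (((show E from X) ⟶ (show E from Y)) →₀ k))

/-- The linear extension of a function on morphisms of `E` to the linearization. -/
noncomputable def Free.linearExtension {X Y : E} (f : (X ⟶ Y) → k) :
    (Free.of k X ⟶ Free.of k Y) →ₗ[k] k :=
  (Finsupp.linearCombination k f : ((X ⟶ Y) →₀ k) →ₗ[k] k)

lemma Free.linearExtension_ofHom {X Y : E} (f : (X ⟶ Y) → k) (g : X ⟶ Y) :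
    Free.linearExtension f (Free.ofHom k g) = f g :=
  (Finsupp.linearCombination_single k 1 g).trans (one_smul k _)

lemma Free.linearExtension_apply {X Y : E} [Fintype (X ⟶ Y)] (f : (X ⟶ Y) → k)
    (x : (X ⟶ Y) →₀ k) : Free.linearExtension f x = ∑ g, x g * f g :=
  (Finsupp.linearCombination_apply k x).trans (Finsupp.sum_fintype _ _ fun _ => zero_smul k _)

lemma Free.linearExtension_comp_ofHom {X Y Z : E} (f : (X ⟶ Z) → k)
    (x : Free.of k X ⟶ Free.of k Y) (b : Y ⟶ Z) :
    Free.linearExtension f (x ≫ Free.ofHom k b) =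
      Free.linearExtension (fun a => f (a ≫ b)) x := by
  induction x using Free.hom_induction with
  | h0 => rw [zero_comp, map_zero, map_zero]
  | hadd x y hx hy => rw [Preadditive.add_comp, map_add, map_add, hx, hy]
  | hsingle c g =>
    rw [Linear.smul_comp, map_smul, map_smul, ← Free.ofHom_comp, Free.linearExtension_ofHom,
      Free.linearExtension_ofHom]

variable [Abelian E] [IsAlgClosed k] [CharZero k]

/-- The endomorphism algebras of the linearization of a finite semi-simple category are
semi-simple. -/
lemma isSemisimpleRing_end_free (hE : IsSemisimpleCat E) (hfin : ∀ X Y : E, Finite (X ⟶ Y))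
    (X : E) : IsSemisimpleRing (End (Free.of k X)) := by
  classical
  have : Module.Finite k (End (Free.of k X)) := finiteDimensional_free_hom _ _
  have : IsArtinianRing (End (Free.of k X)) := IsArtinianRing.of_finite k _
  rw [IsArtinianRing.isSemisimpleRing_iff_jacobson, eq_bot_iff]
  intro x hx
  have hnil : ∀ y ∈ Ring.jacobson (End (Free.of k X)), IsNilpotent y := by
    intro y hy
    obtain ⟨n, hn⟩ := IsArtinianRing.isNilpotent_jacobson_bot (R := End (Free.of k X))
    rw [← Ideal.jacobson_bot] at hy
    have hmem := Ideal.pow_mem_pow hy n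
    rw [hn] at hmem
    exact ⟨n, hmem⟩
  have := Fintype.ofFinite (X ⟶ X)
  obtain ⟨χ, hcyc, hχnil, hχ⟩ := exists_nondegenerate_traceCharacter k hE hfin X
  let x' : (X ⟶ X) →₀ k := x
  have h0 : ∀ b : X ⟶ X, ∑ a, x' a * χ X (a ≫ b) = 0 := by
    intro b
    rw [← Free.linearExtension_apply (fun a => χ X (a ≫ b)) x']
    refine (Free.linearExtension_comp_ofHom (fun c => χ X c) _ b).symm.trans
      ((Free.linearExtension_apply (fun c => χ X c) _).trans ?_)
    exact sum_mul_traceCharacter_eq_zero hE hfin χ hcyc hχnil _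
      (hnil _ (Ideal.mul_mem_left _ (End.of (Free.ofHom k b)) hx))
  change x' = 0
  ext a₀
  -- Fourier inversion: weighting by `χ X (-(a₀ ≫ b))` and summing over `b` isolates the coefficient
  -- at `a₀`, by orthogonality and nondegeneracy.
  have h1 : ∑ b : X ⟶ X, χ X (-(a₀ ≫ b)) * ∑ a, x' a * χ X (a ≫ b) = 0 :=
    Finset.sum_eq_zero fun b _ => by rw [h0, mul_zero]
  have h2 : ∀ a, ∑ b : X ⟶ X, χ X ((a - a₀) ≫ b) = if a = a₀ then
      (Fintype.card (X ⟶ X) : k) else 0 := by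
    intro a
    split_ifs with ha
    · simp [ha]
    · let θ : AddChar (X ⟶ X) k := (χ X).compAddMonoidHom (Preadditive.leftComp X (a - a₀))
      have hθ : θ ≠ 0 := by
        intro hθ
        obtain ⟨b, hb⟩ := hχ (a - a₀) (sub_ne_zero.2 ha)
        exact hb (DFunLike.congr_fun hθ b)
      exact AddChar.sum_eq_zero_iff_ne_zero.2 hθ
  have h3 : ∑ b : X ⟶ X, χ X (-(a₀ ≫ b)) * ∑ a, x' a * χ X (a ≫ b) =
      ∑ a, x' a * ∑ b : X ⟶ X, χ X ((a - a₀) ≫ b) := by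
    simp only [Finset.mul_sum]
    rw [Finset.sum_comm]
    refine Finset.sum_congr rfl fun a _ => Finset.sum_congr rfl fun b _ => ?_
    rw [Preadditive.sub_comp, sub_eq_add_neg, AddChar.map_add_eq_mul]
    ring
  rw [h3] at h1
  simp only [h2, mul_ite, mul_zero, Finset.sum_ite_eq', Finset.mem_univ, if_true] at h1
  exact (mul_eq_zero.1 h1).resolve_right (Nat.cast_ne_zero.2 (Fintype.card_pos_iff.2 ⟨0⟩).ne')

end SemisimpleEnd

/-! ### Regularity of matrices and in the Karoubi envelope -/

section RegularMatrices

/-- The left ideal of `a` is generated by an idempotent `e = s * a`, and right multiplication by `e`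
fixes `a`. -/
lemma exists_mul_mul_eq_self_of_isSemisimpleRing {R : Type*} [Ring R] [IsSemisimpleRing R] (a : R) :
    ∃ g, a * g * a = a := by
  obtain ⟨e, he, h⟩ := IsSemisimpleRing.ideal_eq_span_idempotent (Ideal.span {a})
  obtain ⟨r, hr⟩ := Ideal.mem_span_singleton'.1
    (h ▸ Ideal.mem_span_singleton_self a : a ∈ Ideal.span {e})
  obtain ⟨s, hs⟩ := Ideal.mem_span_singleton'.1
    (h ▸ Ideal.mem_span_singleton_self e : e ∈ Ideal.span {a})
  refine ⟨s, ?_⟩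
  rw [mul_assoc, hs, ← hr, mul_assoc, he]

/-- A rectangular matrix is a corner block of a square matrix over a semi-simple ring; the opposite
corner of a quasi-inverse suffices. -/
lemma exists_matrix_mul_mul_eq_self {R m n : Type*} [Ring R] [IsSemisimpleRing R] [Fintype m]
    [Fintype n] (A : Matrix m n R) : ∃ G : Matrix n m R, A * G * A = A := by
  classical
  have : IsSemisimpleRing (Matrix (m ⊕ n) (m ⊕ n) R) :=
    (Matrix.reindexRingEquiv R (Fintype.equivFin (m ⊕ n)).symm).isSemisimpleRing
  obtain ⟨G, hG⟩ := exists_mul_mul_eq_self_of_isSemisimpleRing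
    (Matrix.fromBlocks 0 A 0 0 : Matrix (m ⊕ n) (m ⊕ n) R)
  refine ⟨G.toBlocks₂₁, ?_⟩
  rw [← Matrix.fromBlocks_toBlocks G] at hG
  simp only [Matrix.fromBlocks_multiply] at hG
  simpa using (Matrix.fromBlocks_inj.1 hG).2.1

/-- If every finite family of objects consists of retracts of an object with semi-simple
endomorphism ring, then all matrices of morphisms are regular. -/
lemma isRegularHom_mat {C : Type u} [Category.{v} C] [Preadditive C]
    (h : ∀ (ι : Type) [Fintype ι] (X : ι → C), ∃ Z : C, IsSemisimpleRing (End Z) ∧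
      ∀ i, Nonempty (Retract (X i) Z)) {M N : Mat_ C} (f : M ⟶ N) : IsRegularHom f := by
  obtain ⟨Z, _, hZ⟩ := h (M.ι ⊕ N.ι) (Sum.elim M.X N.X)
  have rM (i : M.ι) : Retract (M.X i) Z := (hZ (.inl i)).some
  have rN (i : N.ι) : Retract (N.X i) Z := (hZ (.inr i)).some
  -- The indices are transposed because multiplication in `End Z` reverses composition.
  let A : Matrix N.ι M.ι (End Z) := fun b a => (rM a).r ≫ f a b ≫ (rN b).i
  obtain ⟨G, hG⟩ := exists_matrix_mul_mul_eq_self A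
  refine ⟨fun b a => (rN b).i ≫ End.asHom (G a b) ≫ (rM a).r, ?_⟩
  ext a b
  have h1 := congrArg (fun t : Z ⟶ Z => (rM a).i ≫ t ≫ (rN b).r) (congrFun (congrFun hG b) a)
  have h2 : (rM a).i ≫ A b a ≫ (rN b).r = f a b := by simp [A]
  refine Eq.trans ?_ (h1.trans h2)
  have hmul : (A * G * A : Matrix _ _ (End Z)) b a =
      ∑ b', ∑ a', End.asHom (A b' a) ≫ End.asHom (G a' b') ≫ End.asHom (A b a') := by
    rw [Matrix.mul_apply]
    simp only [Matrix.mul_apply]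
    refine Finset.sum_congr rfl fun b' _ => ?_
    exact Preadditive.comp_sum _ _ _
  have hcomp : (f ≫ (show N ⟶ M from fun b a => (rN b).i ≫ End.asHom (G a b) ≫ (rM a).r) ≫ f) a b =
      ∑ b', ∑ a', f a b' ≫ ((rN b').i ≫ End.asHom (G a' b') ≫ (rM a').r) ≫ f a' b := by
    rw [Mat_.comp_apply]
    exact Finset.sum_congr rfl fun b' _ => Preadditive.comp_sum _ _ _
  refine hcomp.trans ?_
  dsimp only
  rw [hmul, Preadditive.sum_comp, Preadditive.comp_sum]
  refine Finset.sum_congr rfl fun b' _ => ?_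
  rw [Preadditive.sum_comp, Preadditive.comp_sum]
  refine Finset.sum_congr rfl fun a' _ => ?_
  simp [A]

/-- A quasi-inverse cut down by the two idempotents still works, since `f` absorbs them. -/
lemma isRegularHom_karoubi {C : Type u} [Category.{v} C]
    (h : ∀ {X Y : C} (f : X ⟶ Y), IsRegularHom f) {P Q : Idempotents.Karoubi C} (f : P ⟶ Q) :
    IsRegularHom f := by
  obtain ⟨g, hg⟩ := h f.f
  refine ⟨⟨Q.p ≫ g ≫ P.p, by simp [P.idem]⟩, ?_⟩
  ext
  simpa using hg

end RegularMatrices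

/-! ### Linear structure and finite dimension of the envelopes -/

section LinearEnvelopes

variable (k : Type w) [Field k] {C : Type u} [Category.{v} C] [Preadditive C] [Linear k C]

instance linearMat : Linear k (Mat_ C) where
  homModule M N :=
    { smul := fun c f i j => c • f i j
      one_smul := fun f => Mat_.hom_ext _ _ fun i j => one_smul k (f i j)
      mul_smul := fun c d f => Mat_.hom_ext _ _ fun i j => mul_smul c d (f i j)
      smul_zero := fun c => Mat_.hom_ext _ _ fun i j => smul_zero c
      smul_add := fun c f g => Mat_.hom_ext _ _ fun i j => smul_add c (f i j) (g i j)
      add_smul := fun c d f => Mat_.hom_ext _ _ fun i j => add_smul c d (f i j)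
      zero_smul := fun f => Mat_.hom_ext _ _ fun i j => zero_smul k (f i j) }
  smul_comp M N K c f g := Mat_.hom_ext _ _ fun i j => by
    change ∑ l, (c • f i l) ≫ g l j = c • ∑ l, f i l ≫ g l j
    simp [Finset.smul_sum]
  comp_smul M N K f c g := Mat_.hom_ext _ _ fun i j => by
    change ∑ l, f i l ≫ (c • g l j) = c • ∑ l, f i l ≫ g l j
    simp [Finset.smul_sum]

instance finiteDimensional_mat_hom [∀ X Y : C, FiniteDimensional k (X ⟶ Y)] (M N : Mat_ C) :
    FiniteDimensional k (M ⟶ N) :=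
  FiniteDimensional.of_injective
    ({ toFun := fun f i j => f i j
       map_add' := fun _ _ => rfl
       map_smul' := fun _ _ => rfl } : (M ⟶ N) →ₗ[k] ∀ i j, (M.X i ⟶ N.X j))
    fun _ _ h => h

instance linearKaroubi : Linear k (Idempotents.Karoubi C) where
  homModule P Q :=
    { smul := fun c f => ⟨c • f.f, by simp⟩
      one_smul := fun f => Idempotents.Karoubi.hom_ext _ _ (one_smul k f.f)
      mul_smul := fun c d f => Idempotents.Karoubi.hom_ext _ _ (mul_smul c d f.f)
      smul_zero := fun c => Idempotents.Karoubi.hom_ext _ _ (smul_zero c)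
      smul_add := fun c f g => Idempotents.Karoubi.hom_ext _ _ (smul_add c f.f g.f)
      add_smul := fun c d f => Idempotents.Karoubi.hom_ext _ _ (add_smul c d f.f)
      zero_smul := fun f => Idempotents.Karoubi.hom_ext _ _ (zero_smul k f.f) }
  smul_comp P Q R c f g := Idempotents.Karoubi.hom_ext _ _ (Linear.smul_comp _ _ _ c f.f g.f)
  comp_smul P Q R f c g := Idempotents.Karoubi.hom_ext _ _ (Linear.comp_smul _ _ _ f.f c g.f)

instance finiteDimensional_karoubi_hom [∀ X Y : C, FiniteDimensional k (X ⟶ Y)]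
    (P Q : Idempotents.Karoubi C) : FiniteDimensional k (P ⟶ Q) :=
  FiniteDimensional.of_injective
    ({ toFun := fun f => f.f
       map_add' := fun _ _ => rfl
       map_smul' := fun _ _ => rfl } : (P ⟶ Q) →ₗ[k] (P.X ⟶ Q.X))
    fun _ _ h => Idempotents.Karoubi.hom_ext _ _ h

end LinearEnvelopes

end CategoryTheory

/-! ### The main theorem -/

theorem mainTheorem3 (k : Type w) [Field k] [IsAlgClosed k] [CharZero k]
    (E : Type u) [Category.{v} E] [Abelian E] (hE : IsSemisimpleCat E)
    (hfin : ∀ X Y : E, Finite (X ⟶ Y)) :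
    ∃ A : Abelian (AdditiveKaroubi (Linearization k E)),
      A.toPreadditive =
          (inferInstance : Preadditive (AdditiveKaroubi (Linearization k E))) ∧
        @IsSemisimpleCat (AdditiveKaroubi (Linearization k E)) _ A := by
  have hmat : ∀ {M N : Mat_ (Linearization k E)} (f : M ⟶ N), IsRegularHom f := by
    refine isRegularHom_mat fun ι _ X => ?_
    have : HasFiniteBiproducts E := Abelian.hasFiniteBiproducts
    classical
    let X' : ι → E := fun i => X i
    -- Linearization does not preserve biproducts, but like any functor it preserves retracts, and
    -- these are enough.
    let R (i : ι) : Retract (X' i) (⨁ X') := ⟨biproduct.ι X' i, biproduct.π X' i, by simp⟩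
    exact ⟨Free.of k (⨁ X'), isSemisimpleRing_end_free hE hfin _,
      fun i => ⟨(R i).map (Free.embedding k E)⟩⟩
  have hreg : ∀ {P Q : AdditiveKaroubi (Linearization k E)} (f : P ⟶ Q), IsRegularHom f :=
    isRegularHom_karoubi hmat
  let A : Abelian (AdditiveKaroubi (Linearization k E)) := abelianOfIsRegularHom hreg
  refine ⟨A, rfl, fun X => ?_⟩
  let L : @Linear k _ (AdditiveKaroubi (Linearization k E)) _ A.toPreadditive :=
    linearKaroubi (C := Mat_ (Linearization k E)) k
  have (X Y : AdditiveKaroubi (Linearization k E)) : FiniteDimensional k (X ⟶ Y) :=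
    finiteDimensional_karoubi_hom k X Y
  exact (isFiniteSumOfSimples_of_isRegularHom k hreg X).exists_iso_biproduct
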